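/- Let $n,s,t$ be integers with $n\ge 10$, $s,t\ge 2$ and $n-1\ge s+t$. For elements $x,y$ of a group write $[x,y]=x^{-1}y^{-1}xy$. Let $H$ be the group generated by $\rho_0,\rho_1,\rho_2$ subject to the defining relations $$\rho_0^2=\rho_1^2=\rho_2^2=(\rho_0\rho_1)^{2^s}=(\rho_1\rho_2)^{2^t}=(\rho_0\rho_2)^2=[(\rho_0\rho_1)^4,\rho_2]=[\rho_0,(\rho_1\rho_2)^4]=1$$ together with the relation $$[(\rho_0\rho_1)^2,\rho_2]^{2^{(n-s-t-1)/2}}=1\quad\text{if } n-s-t \text{ is odd},\qquad [(\rho_0\rho_1)^2,(\rho_1\rho_2)^2]^{2^{(n-s-t-2)/2}}=1\quad\text{if } n-s-t\text{ is even}.$$ Then $(H,\{\rho_0,\rho_1,\rho_2\})$ is a string C-group of rank $3$, of order $|H|=2^n$ and of Schläfli type $\{2^s,2^t\}$. In particular, there exists a string C-group of order $2^n$ with Schläfli type $\{2^s,2^t\}$. Here a group $G$ with generators $\rho_0,\dots,\rho_{d-1}$ is a string C-group of rank $d$ if each $\rho_i$ has order exactly $2$, $\rho_i$ and $\rho_j$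 commute whenever $|i-j|>1$, and $G_I\cap G_J=G_{I\cap J}$ for all $I,J\subseteq\{0,\dots,d-1\}$, where $G_I=\langle\rho_i : i\in I\rangle$. Its order is $|G|$, and its Schläfli type is $\{p_1,\dots,p_{d-1}\}$, where $p_i$ is the order of $\rho_{i-1}\rho_i$. -/

import Mathlib

namespace StringC

/-- The pair `(G, {ρ 0, …, ρ (d-1)})` is a string C-group of rank `d`. -/
structure IsStringCGroup {G : Type*} [Group G] {d : ℕ} (ρ : Fin d → G) : Prop where
  /-- every `ρ i` is an involution -/
  involution : ∀ i, orderOf (ρ i) = 2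
  /-- the `ρ i` generate `G` -/
  generates : Subgroup.closure (Set.range ρ) = ⊤
  /-- string property: generators whose indices differ by more than one commute -/
  string : ∀ i j : Fin d, (i : ℕ) + 1 < (j : ℕ) → Commute (ρ i) (ρ j)
  /-- intersection property -/
  intersection : ∀ I J : Set (Fin d),
    Subgroup.closure (ρ '' I) ⊓ Subgroup.closure (ρ '' J) = Subgroup.closure (ρ '' (I ∩ J))

/-- `(G, {ρ 0, …, ρ d})` has Schläfli type `{p 0, …, p (d-1)}`: the order of
`ρ i * ρ (i+1)` is `p i`. -/
def HasSchlafliType {G : Type*} [Group G] {d : ℕ} (ρ : Fin (d + 1) → G) (p : Fin d → ℕ) : Prop :=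
  ∀ i : Fin d, orderOf (ρ i.castSucc * ρ i.succ) = p i

/-- The commutator `[x, y] = x⁻¹ y⁻¹ x y` (Mathlib's `⁅x, y⁆` is `x y x⁻¹ y⁻¹`). -/
def comm {G : Type*} [Group G] (x y : G) : G := x⁻¹ * y⁻¹ * x * y

/-- The relators common to both parities, for `r₀, r₁, r₂` in a group. -/
def baseRelators {G : Type*} [Group G] (s t : ℕ) (r₀ r₁ r₂ : G) : Set G :=
  {r₀ ^ 2, r₁ ^ 2, r₂ ^ 2, (r₀ * r₁) ^ 2 ^ s, (r₁ * r₂) ^ 2 ^ t, (r₀ * r₂) ^ 2,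
    comm ((r₀ * r₁) ^ 4) r₂, comm r₀ ((r₁ * r₂) ^ 4)}

/-- The additional relator, which depends on the parity of `n - s - t`. It is used only for
`n - 1 ≥ s + t`, where none of the subtractions truncates and the divisions are exact. -/
def extraRelator {G : Type*} [Group G] (n s t : ℕ) (r₀ r₁ r₂ : G) : G :=
  if Odd (n - s - t) then comm ((r₀ * r₁) ^ 2) r₂ ^ 2 ^ ((n - s - t - 1) / 2)
  else comm ((r₀ * r₁) ^ 2) ((r₁ * r₂) ^ 2) ^ 2 ^ ((n - s - t - 2) / 2)

/-- All relators of `H`, as words in the free group on three generators. -/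
def relators (n s t : ℕ) : Set (FreeGroup (Fin 3)) :=
  insert (extraRelator n s t (FreeGroup.of 0) (FreeGroup.of 1) (FreeGroup.of 2))
    (baseRelators s t (FreeGroup.of 0) (FreeGroup.of 1) (FreeGroup.of 2))

/-- The finitely presented group `H`. -/
abbrev H (n s t : ℕ) : Type := PresentedGroup (relators n s t)

/-- The generators `ρ₀, ρ₁, ρ₂` of `H`. -/
def gen (n s t : ℕ) : Fin 3 → H n s t := fun i => PresentedGroup.of i

end StringC

/-!
Write `ρ₀, ρ₁, ρ₂` for the generators of `H n s t`. The powers `(ρ₀ρ₁)⁴` and `(ρ₁ρ₂)⁴` commute and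
generate a normal subgroup of order `2 ^ (s - 2) * 2 ^ (t - 2)`, and the quotient by it is
`H (n - (s - 2) - (t - 2)) 2 2`. This is a quotient of the Coxeter group `[4, 4]`, the symmetry
group of the tiling of the plane by unit squares, in which the unit translations `X` and `Y` along
the axes generate a subgroup of index dividing `8`; the parity-dependent relation becomes
`Y ^ m = 1` or `X ^ m * Y ^ m = 1` with `m` a power of `2`, which bounds the order from above. The
bound is attained by the wreath product of the dihedral group of order `2 * m` with the group of
order two in the first case, and, in the second case, by the wreath product of the dihedral group of
order `4 * m` with that group, modulo the diagonal central involution.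

Killing any set of generators respects the relations, so `H n s t` retracts onto each subgroup
`⟨ρ i : i ∈ I⟩`, and these retractions give the intersection property.
-/

namespace StringC

section Groups

open Subgroup

variable {G K : Type*} [Group G] [Group K]

lemma card_sup {A B : Subgroup G} (h : B ≤ normalizer A) :
    Nat.card ↥(A ⊔ B) = Nat.card A * A.relIndex B := by
  have h_index : A.relIndex (A ⊔ B) = A.relIndex B := by
    have := normal_subgroupOf_of_le_normalizer h
    have := normal_subgroupOf_sup_of_le_normalizer h
    rw [sup_comm]
    exact (Nat.card_congr (QuotientGroup.quotientInfEquivProdNormalizerQuotient B A h).toEquiv).symm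
  rw [← h_index, ← relIndex_bot_left A, relIndex_mul_relIndex _ _ _ bot_le le_sup_left,
    relIndex_bot_left]

lemma card_sup_dvd {A B : Subgroup G} (h : B ≤ normalizer A) :
    Nat.card ↥(A ⊔ B) ∣ Nat.card A * Nat.card B := by
  rw [card_sup h]
  exact mul_dvd_mul_left _ (relIndex_dvd_card A B)

lemma card_sup_of_disjoint {A B : Subgroup G} (h : B ≤ normalizer A) (h_disj : Disjoint A B) :
    Nat.card ↥(A ⊔ B) = Nat.card A * Nat.card B := by
  rw [card_sup h, ← inf_relIndex_right, h_disj.eq_bot, relIndex_bot_left]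

lemma closure_pair (u v : G) : closure {u, v} = zpowers u ⊔ zpowers v := by
  rw [Set.insert_eq, Subgroup.closure_union, zpowers_eq_closure, zpowers_eq_closure]

lemma zpowers_le_normalizer_zpowers {u v : G} (h : Commute u v) :
    zpowers v ≤ normalizer (zpowers u) := by
  rw [zpowers_eq_closure u, le_normalizer_closure_iff]
  rintro _ ⟨k, rfl⟩ _ rfl
  rw [(h.zpow_right k).symm.eq, mul_inv_cancel_right]
  exact mem_closure_singleton_self _

lemma card_closure_pair_dvd {u v : G} (h : Commute u v) :
    Nat.card (closure {u, v}) ∣ orderOf u * orderOf v := by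
  rw [closure_pair, ← Nat.card_zpowers, ← Nat.card_zpowers]
  exact card_sup_dvd (zpowers_le_normalizer_zpowers h)

lemma card_closure_pair_of_disjoint {u v : G} (h : Commute u v)
    (h_disj : Disjoint (zpowers u) (zpowers v)) :
    Nat.card (closure {u, v}) = orderOf u * orderOf v := by
  rw [closure_pair, card_sup_of_disjoint (zpowers_le_normalizer_zpowers h) h_disj,
    Nat.card_zpowers, Nat.card_zpowers]

lemma mem_normalizer_closure_of_mul_self {g : G} {T : Set G} (hg : g * g = 1)
    (h : ∀ x ∈ T, g * x * g⁻¹ ∈ closure T) : g ∈ normalizer (closure T) := by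
  have h_le : closure T ≤ (closure T).comap (MulAut.conj g).toMonoidHom := by
    rwa [closure_le]
  refine mem_normalizer_iff.2 fun x => ⟨fun hx => h_le hx, fun hx => ?_⟩
  have h_conj : g * (g * x * g⁻¹) * g⁻¹ = x := by
    calc g * (g * x * g⁻¹) * g⁻¹ = (g * g) * x * (g * g)⁻¹ := by group
      _ = x := by rw [hg, one_mul, inv_one, mul_one]
  exact h_conj ▸ h_le hx

lemma closure_normal_of_mul_self {S T : Set G} (hS : closure S = ⊤) (h_inv : ∀ g ∈ S, g * g = 1)
    (h : ∀ g ∈ S, ∀ x ∈ T, g * x * g⁻¹ ∈ closure T) : (closure T).Normal := by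
  rw [← normalizer_eq_top_iff, eq_top_iff, ← hS, closure_le]
  exact fun g hg => mem_normalizer_closure_of_mul_self (h_inv g hg) (h g hg)

lemma zpowers_normal_of_mem_center {z : G} (hz : z ∈ center G) : (zpowers z).Normal :=
  ⟨fun x hx g => by
    have hx_center : x ∈ center G := zpowers_le.2 hz hx
    rwa [mem_center_iff.1 hx_center g, mul_inv_cancel_right]⟩

lemma card_dvd_card_quotient_mul_of_pow_eq_one {z : G} {k : ℕ} (hz : z ^ k = 1) :
    Nat.card G ∣ Nat.card (G ⧸ zpowers z) * k := by
  rw [(zpowers z).card_eq_card_quotient_mul_card_subgroup, Nat.card_zpowers]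
  exact mul_dvd_mul_left _ (orderOf_dvd_of_pow_eq_one hz)

lemma closure_map_triple {f : G →* K} (hf : Function.Surjective f) {a b c : G}
    (h : closure {a, b, c} = ⊤) : closure {f a, f b, f c} = ⊤ := by
  rw [← map_top_of_surjective f hf, ← h, MonoidHom.map_closure, Set.image_insert_eq, Set.image_pair]

lemma orderOf_pow_four {g : G} {k : ℕ} (h : orderOf g = 2 ^ (k + 2)) :
    orderOf (g ^ 4) = 2 ^ k := by
  have h_mul : 2 ^ (k + 2) = 2 ^ k * 4 := pow_add 2 k 2
  rw [orderOf_pow_of_dvd four_ne_zero (h ▸ h_mul ▸ dvd_mul_left _ _), h, h_mul,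
    Nat.mul_div_cancel _ four_pos]

end Groups

section Involutions

variable {G : Type*} [Group G] {a b : G}

lemma conj_left_mul_pow (ha : a * a = 1) (hb : b * b = 1) (k : ℕ) :
    a * (a * b) ^ k * a⁻¹ = ((a * b) ^ k)⁻¹ := by
  rw [← conj_pow, ← inv_pow, mul_inv_rev, inv_eq_of_mul_eq_one_left ha,
    inv_eq_of_mul_eq_one_left hb, ← mul_assoc a a b, ha, one_mul]

lemma conj_right_mul_pow (ha : a * a = 1) (hb : b * b = 1) (k : ℕ) :
    b * (a * b) ^ k * b⁻¹ = ((a * b) ^ k)⁻¹ := by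
  rw [← conj_pow, ← inv_pow, mul_inv_rev, inv_eq_of_mul_eq_one_left ha,
    inv_eq_of_mul_eq_one_left hb, mul_assoc b (a * b) b, mul_assoc a b b, hb, mul_one]

lemma mul_sq_eq_one_iff_commute (ha : a * a = 1) (hb : b * b = 1) :
    (a * b) ^ 2 = 1 ↔ Commute a b := by
  rw [pow_two, mul_eq_one_iff_eq_inv, mul_inv_rev, inv_eq_of_mul_eq_one_left ha,
    inv_eq_of_mul_eq_one_left hb]
  exact Iff.rfl

lemma pow_two_pow_eq_one_of_le {i j : ℕ} (hij : i ≤ j) (h : a ^ 2 ^ i = 1) : a ^ 2 ^ j = 1 :=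
  orderOf_dvd_iff_pow_eq_one.1 ((orderOf_dvd_of_pow_eq_one h).trans (pow_dvd_pow 2 hij))

lemma pow_two_pow_eq_one (ha : a * a = 1) {k : ℕ} (hk : 1 ≤ k) : a ^ 2 ^ k = 1 :=
  pow_two_pow_eq_one_of_le hk (by rwa [pow_one, pow_two])

lemma pow_four_eq_one (ha : a * a = 1) : a ^ 4 = 1 :=
  pow_two_pow_eq_one ha one_le_two

end Involutions

section Relations

variable {G K : Type*} [Group G] [Group K] {n s t : ℕ} {r₀ r₁ r₂ : G}

lemma comm_eq_one_iff {x y : G} : comm x y = 1 ↔ Commute x y := by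
  rw [comm, mul_assoc, ← mul_inv_rev, inv_mul_eq_one, eq_comm]
  exact Iff.rfl

lemma comm_one_left (x : G) : comm 1 x = 1 := comm_eq_one_iff.2 (Commute.one_left x)

lemma comm_one_right (x : G) : comm x 1 = 1 := comm_eq_one_iff.2 (Commute.one_right x)

lemma map_comm (f : G →* K) (x y : G) : f (comm x y) = comm (f x) (f y) := by
  simp only [comm, map_mul, map_inv]

lemma map_extraRelator (f : G →* K) (n s t : ℕ) (a b c : G) :
    f (extraRelator n s t a b c) = extraRelator n s t (f a) (f b) (f c) := by
  simp only [extraRelator, apply_ite f, map_comm, map_pow, map_mul]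

lemma image_baseRelators (f : G →* K) (s t : ℕ) (a b c : G) :
    f '' baseRelators s t a b c = baseRelators s t (f a) (f b) (f c) := by
  simp only [baseRelators, Set.image_insert_eq, Set.image_singleton, map_comm, map_pow, map_mul]

/-- The elements `r₀, r₁, r₂` satisfy the defining relations of `H n s t`, the parity-dependent one
excepted. For `s = t = 2` these are the relations of the Coxeter group `[4, 4]`. -/
structure BaseRelations (s t : ℕ) (r₀ r₁ r₂ : G) : Prop where
  mul_self₀ : r₀ * r₀ = 1
  mul_self₁ : r₁ * r₁ = 1
  mul_self₂ : r₂ * r₂ = 1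
  pow₀₁ : (r₀ * r₁) ^ 2 ^ s = 1
  pow₁₂ : (r₁ * r₂) ^ 2 ^ t = 1
  commute₀₂ : Commute r₀ r₂
  commute_pow₀₁ : Commute ((r₀ * r₁) ^ 4) r₂
  commute_pow₁₂ : Commute r₀ ((r₁ * r₂) ^ 4)

lemma baseRelations_iff : BaseRelations s t r₀ r₁ r₂ ↔ ∀ w ∈ baseRelators s t r₀ r₁ r₂, w = 1 := by
  simp only [baseRelators, Set.mem_insert_iff, Set.mem_singleton_iff, forall_eq_or_imp, forall_eq,
    comm_eq_one_iff]
  constructor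
  · rintro ⟨h₀, h₁, h₂, h₀₁, h₁₂, h₀₂, hA, hB⟩
    exact ⟨(pow_two _).trans h₀, (pow_two _).trans h₁, (pow_two _).trans h₂, h₀₁, h₁₂,
      (mul_sq_eq_one_iff_commute h₀ h₂).2 h₀₂, hA, hB⟩
  · rintro ⟨h₀, h₁, h₂, h₀₁, h₁₂, h₀₂, hA, hB⟩
    rw [pow_two] at h₀ h₁ h₂
    exact ⟨h₀, h₁, h₂, h₀₁, h₁₂, (mul_sq_eq_one_iff_commute h₀ h₂).1 h₀₂, hA, hB⟩

namespace BaseRelations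

lemma map (h : BaseRelations s t r₀ r₁ r₂) (f : G →* K) :
    BaseRelations s t (f r₀) (f r₁) (f r₂) := by
  rw [baseRelations_iff, ← image_baseRelators]
  rintro _ ⟨w, hw, rfl⟩
  rw [baseRelations_iff.1 h w hw, map_one]

lemma of_pow_four (h₀ : r₀ * r₀ = 1) (h₁ : r₁ * r₁ = 1) (h₂ : r₂ * r₂ = 1)
    (h₀₁ : (r₀ * r₁) ^ 4 = 1) (h₁₂ : (r₁ * r₂) ^ 4 = 1) (h₀₂ : Commute r₀ r₂) :
    BaseRelations 2 2 r₀ r₁ r₂ :=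
  ⟨h₀, h₁, h₂, h₀₁, h₁₂, h₀₂, h₀₁ ▸ Commute.one_left _, h₁₂ ▸ Commute.one_right _⟩

lemma mono {s' t' : ℕ} (hs : s ≤ s') (ht : t ≤ t') (h : BaseRelations s t r₀ r₁ r₂) :
    BaseRelations s' t' r₀ r₁ r₂ :=
  { h with
    pow₀₁ := pow_two_pow_eq_one_of_le hs h.pow₀₁
    pow₁₂ := pow_two_pow_eq_one_of_le ht h.pow₁₂ }

lemma mul_self (h : BaseRelations s t r₀ r₁ r₂) : ∀ g ∈ ({r₀, r₁, r₂} : Set G), g * g = 1 := by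
  rintro g (rfl | rfl | rfl)
  exacts [h.mul_self₀, h.mul_self₁, h.mul_self₂]

lemma commute_pow_pow (h : BaseRelations s t r₀ r₁ r₂) :
    Commute ((r₀ * r₁) ^ 4) ((r₁ * r₂) ^ 4) := by
  have h_conj : Commute ((r₀ * r₁) ^ 4) (r₁ * r₂ * r₁⁻¹) := by
    have := h.commute_pow₀₁.inv_left.conj r₁
    rwa [← conj_right_mul_pow h.mul_self₀ h.mul_self₁, mul_assoc r₁ (r₁ * _ * _),
      mul_assoc (r₁ * _), ← mul_inv_rev, h.mul_self₁, inv_one, mul_one, ← mul_assoc, h.mul_self₁,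
      one_mul] at this
  have h_pow : (r₁ * r₂) ^ 4 = (r₁ * r₂ * r₁⁻¹ * r₂) ^ 2 := by
    rw [inv_eq_of_mul_eq_one_left h.mul_self₁]
    simp only [pow_succ, pow_zero, one_mul, mul_assoc]
  exact h_pow ▸ (h_conj.mul_right h.commute_pow₀₁).pow_right 2

lemma closure_pow_four_normal (h : BaseRelations s t r₀ r₁ r₂)
    (hgen : Subgroup.closure {r₀, r₁, r₂} = ⊤) :
    (Subgroup.closure {(r₀ * r₁) ^ 4, (r₁ * r₂) ^ 4}).Normal := by
  have hA : (r₀ * r₁) ^ 4 ∈ Subgroup.closure {(r₀ * r₁) ^ 4, (r₁ * r₂) ^ 4} :=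
    Subgroup.subset_closure (by simp)
  have hB : (r₁ * r₂) ^ 4 ∈ Subgroup.closure {(r₀ * r₁) ^ 4, (r₁ * r₂) ^ 4} :=
    Subgroup.subset_closure (by simp)
  refine closure_normal_of_mul_self hgen h.mul_self ?_
  rintro g (rfl | rfl | rfl) x (rfl | rfl)
  · rw [conj_left_mul_pow h.mul_self₀ h.mul_self₁]; exact inv_mem hA
  · rw [h.commute_pow₁₂.eq, mul_inv_cancel_right]; exact hB
  · rw [conj_right_mul_pow h.mul_self₀ h.mul_self₁]; exact inv_mem hA
  · rw [conj_left_mul_pow h.mul_self₁ h.mul_self₂]; exact inv_mem hB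
  · rw [h.commute_pow₀₁.symm.eq, mul_inv_cancel_right]; exact hA
  · rw [conj_right_mul_pow h.mul_self₁ h.mul_self₂]; exact inv_mem hB

end BaseRelations

/-- The elements `r₀, r₁, r₂` satisfy the defining relations of `H n s t`. -/
structure Realizes (n s t : ℕ) (r₀ r₁ r₂ : G) : Prop extends BaseRelations s t r₀ r₁ r₂ where
  extra : extraRelator n s t r₀ r₁ r₂ = 1

lemma Realizes.map (h : Realizes n s t r₀ r₁ r₂) (f : G →* K) :
    Realizes n s t (f r₀) (f r₁) (f r₂) :=
  ⟨h.toBaseRelations.map f, by rw [← map_extraRelator, h.extra, map_one]⟩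

/-- The homomorphism out of `H n s t` determined by elements that satisfy its relations. -/
def Realizes.lift (h : Realizes n s t r₀ r₁ r₂) : H n s t →* G :=
  PresentedGroup.toGroup (f := ![r₀, r₁, r₂]) <| by
    rintro w (rfl | hw)
    · rw [map_extraRelator]
      simpa using h.extra
    · refine baseRelations_iff.1 h.toBaseRelations _ ?_
      simpa [image_baseRelators] using Set.mem_image_of_mem (FreeGroup.lift ![r₀, r₁, r₂]) hw

lemma Realizes.lift_gen (h : Realizes n s t r₀ r₁ r₂) (i : Fin 3) :
    h.lift (gen n s t i) = ![r₀, r₁, r₂] i :=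
  PresentedGroup.toGroup.of _

lemma Realizes.lift_surjective (h : Realizes n s t r₀ r₁ r₂)
    (hgen : Subgroup.closure {r₀, r₁, r₂} = ⊤) : Function.Surjective h.lift := by
  rw [← MonoidHom.range_eq_top, eq_top_iff, ← hgen, Subgroup.closure_le]
  rintro g (rfl | rfl | rfl)
  exacts [⟨_, h.lift_gen 0⟩, ⟨_, h.lift_gen 1⟩, ⟨_, h.lift_gen 2⟩]

lemma gen_realizes (n s t : ℕ) : Realizes n s t (gen n s t 0) (gen n s t 1) (gen n s t 2) where
  toBaseRelations := by
    change BaseRelations s t (PresentedGroup.mk (relators n s t) (FreeGroup.of 0))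
      (PresentedGroup.mk _ (FreeGroup.of 1)) (PresentedGroup.mk _ (FreeGroup.of 2))
    rw [baseRelations_iff, ← image_baseRelators]
    rintro _ ⟨w, hw, rfl⟩
    exact PresentedGroup.one_of_mem (Or.inr hw)
  extra := by
    have h := PresentedGroup.one_of_mem (rels := relators n s t) (Or.inl rfl)
    rwa [map_extraRelator] at h

lemma closure_range_gen (n s t : ℕ) : Subgroup.closure (Set.range (gen n s t)) = ⊤ :=
  PresentedGroup.closure_range_of _

lemma closure_gen (n s t : ℕ) :
    Subgroup.closure {gen n s t 0, gen n s t 1, gen n s t 2} = ⊤ := by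
  rw [← closure_range_gen n s t]
  congr 1
  ext x
  simp [Fin.exists_fin_succ, eq_comm]

end Relations

section Retraction

variable {G : Type*} [Group G] {n s t : ℕ} {a b c : G}

lemma realizes_one_left (hs : 1 ≤ s) (hb : b * b = 1) (hc : c * c = 1)
    (hbc : (b * c) ^ 2 ^ t = 1) : Realizes n s t 1 b c where
  mul_self₀ := one_mul 1
  mul_self₁ := hb
  mul_self₂ := hc
  pow₀₁ := by rw [one_mul, pow_two_pow_eq_one hb hs]
  pow₁₂ := hbc
  commute₀₂ := Commute.one_left _
  commute_pow₀₁ := by rw [one_mul, pow_four_eq_one hb]; exact Commute.one_left _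
  commute_pow₁₂ := Commute.one_left _
  extra := by
    unfold extraRelator
    split_ifs <;> simp [comm_one_left, pow_two, hb]

lemma realizes_one_mid (hs : 1 ≤ s) (ht : 1 ≤ t) (ha : a * a = 1) (hc : c * c = 1)
    (hac : Commute a c) : Realizes n s t a 1 c where
  mul_self₀ := ha
  mul_self₁ := one_mul 1
  mul_self₂ := hc
  pow₀₁ := by rw [mul_one, pow_two_pow_eq_one ha hs]
  pow₁₂ := by rw [one_mul, pow_two_pow_eq_one hc ht]
  commute₀₂ := hac
  commute_pow₀₁ := by rw [mul_one, pow_four_eq_one ha]; exact Commute.one_left _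
  commute_pow₁₂ := by rw [one_mul, pow_four_eq_one hc]; exact Commute.one_right _
  extra := by
    unfold extraRelator
    split_ifs <;> simp [comm_one_left, pow_two, ha]

lemma realizes_one_right (ht : 1 ≤ t) (ha : a * a = 1) (hb : b * b = 1)
    (hab : (a * b) ^ 2 ^ s = 1) : Realizes n s t a b 1 where
  mul_self₀ := ha
  mul_self₁ := hb
  mul_self₂ := one_mul 1
  pow₀₁ := hab
  pow₁₂ := by rw [mul_one, pow_two_pow_eq_one hb ht]
  commute₀₂ := Commute.one_right _
  commute_pow₀₁ := Commute.one_right _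
  commute_pow₁₂ := by rw [mul_one, pow_four_eq_one hb]; exact Commute.one_right _
  extra := by
    unfold extraRelator
    split_ifs <;> simp [comm_one_right, pow_two, hb]

lemma Realizes.ite₀ (hs : 1 ≤ s) (h : Realizes n s t a b c) (p : Prop) [Decidable p] :
    Realizes n s t (if p then a else 1) b c := by
  split_ifs
  exacts [h, realizes_one_left hs h.mul_self₁ h.mul_self₂ h.pow₁₂]

lemma Realizes.ite₁ (hs : 1 ≤ s) (ht : 1 ≤ t) (h : Realizes n s t a b c) (p : Prop) [Decidable p] :
    Realizes n s t a (if p then b else 1) c := by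
  split_ifs
  exacts [h, realizes_one_mid hs ht h.mul_self₀ h.mul_self₂ h.commute₀₂]

lemma Realizes.ite₂ (ht : 1 ≤ t) (h : Realizes n s t a b c) (p : Prop) [Decidable p] :
    Realizes n s t a b (if p then c else 1) := by
  split_ifs
  exacts [h, realizes_one_right ht h.mul_self₀ h.mul_self₁ h.pow₀₁]

open scoped Classical in
lemma exists_retraction (hs : 1 ≤ s) (ht : 1 ≤ t) (I : Set (Fin 3)) :
    ∃ f : H n s t →* H n s t, ∀ i, f (gen n s t i) = if i ∈ I then gen n s t i else 1 := by
  have h := (((gen_realizes n s t).ite₀ hs (0 ∈ I)).ite₁ hs ht (1 ∈ I)).ite₂ ht (2 ∈ I)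
  refine ⟨h.lift, fun i => ?_⟩
  rw [h.lift_gen]
  fin_cases i <;> rfl

lemma closure_image_inf_closure_image {ι : Type*} {ρ : ι → G} {I : Set ι} {f : G →* G}
    (hf_mem : ∀ i ∈ I, f (ρ i) = ρ i) (hf_notMem : ∀ i ∉ I, f (ρ i) = 1) (J : Set ι) :
    Subgroup.closure (ρ '' I) ⊓ Subgroup.closure (ρ '' J) = Subgroup.closure (ρ '' (I ∩ J)) := by
  refine le_antisymm ?_ (le_inf (Subgroup.closure_mono (Set.image_mono Set.inter_subset_left))
    (Subgroup.closure_mono (Set.image_mono Set.inter_subset_right)))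
  have h_fix : Set.EqOn f (MonoidHom.id G) (Subgroup.closure (ρ '' I)) := by
    refine MonoidHom.eqOn_closure ?_
    rintro _ ⟨i, hi, rfl⟩
    exact hf_mem i hi
  have h_map : (Subgroup.closure (ρ '' J)).map f ≤ Subgroup.closure (ρ '' (I ∩ J)) := by
    rw [MonoidHom.map_closure, Subgroup.closure_le]
    rintro _ ⟨_, ⟨j, hj, rfl⟩, rfl⟩
    by_cases hi : j ∈ I
    · rw [hf_mem j hi]
      exact Subgroup.subset_closure ⟨j, ⟨hi, hj⟩, rfl⟩
    · rw [hf_notMem j hi]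
      exact one_mem _
  rintro x ⟨hI, hJ⟩
  have hx : f x = x := h_fix hI
  exact hx ▸ h_map ⟨x, hJ, rfl⟩

lemma gen_intersection (hs : 1 ≤ s) (ht : 1 ≤ t) (I J : Set (Fin 3)) :
    Subgroup.closure (gen n s t '' I) ⊓ Subgroup.closure (gen n s t '' J) =
      Subgroup.closure (gen n s t '' (I ∩ J)) := by
  obtain ⟨f, hf⟩ := exists_retraction (n := n) hs ht I
  exact closure_image_inf_closure_image (fun i hi => by rw [hf, if_pos hi])
    (fun i hi => by rw [hf, if_neg hi]) J

end Retraction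

section Orders

open DihedralGroup

variable {n s t : ℕ}

lemma dihedral_realizes_left (ht : 1 ≤ t) :
    Realizes n s t (sr 0 : DihedralGroup (2 ^ s)) (sr 1) 1 :=
  realizes_one_right ht (sr_mul_self _) (sr_mul_self _) (by simp)

lemma dihedral_realizes_right (hs : 1 ≤ s) :
    Realizes n s t 1 (sr 0 : DihedralGroup (2 ^ t)) (sr 1) :=
  realizes_one_left hs (sr_mul_self _) (sr_mul_self _) (by simp)

lemma orderOf_gen₀₁ (ht : 1 ≤ t) : orderOf (gen n s t 0 * gen n s t 1) = 2 ^ s := by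
  refine Nat.dvd_antisymm (orderOf_dvd_of_pow_eq_one (gen_realizes n s t).pow₀₁) ?_
  have h := orderOf_map_dvd (dihedral_realizes_left (n := n) (s := s) ht).lift
    (gen n s t 0 * gen n s t 1)
  rw [map_mul, Realizes.lift_gen, Realizes.lift_gen] at h
  simpa [sr_mul_sr] using h

lemma orderOf_gen₁₂ (hs : 1 ≤ s) : orderOf (gen n s t 1 * gen n s t 2) = 2 ^ t := by
  refine Nat.dvd_antisymm (orderOf_dvd_of_pow_eq_one (gen_realizes n s t).pow₁₂) ?_
  have h := orderOf_map_dvd (dihedral_realizes_right (n := n) (t := t) hs).lift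
    (gen n s t 1 * gen n s t 2)
  rw [map_mul, Realizes.lift_gen, Realizes.lift_gen] at h
  simpa [sr_mul_sr] using h

lemma hasSchlafliType_gen (hs : 1 ≤ s) (ht : 1 ≤ t) :
    HasSchlafliType (gen n s t) ![2 ^ s, 2 ^ t] := by
  intro i
  fin_cases i
  exacts [orderOf_gen₀₁ ht, orderOf_gen₁₂ hs]

lemma orderOf_gen (hs : 1 ≤ s) (ht : 1 ≤ t) (i : Fin 3) : orderOf (gen n s t i) = 2 := by
  have h := gen_realizes n s t
  have h_sq : gen n s t i ^ 2 = 1 := by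
    rw [pow_two]
    exact h.mul_self _ (by fin_cases i <;> simp)
  have h_ne : gen n s t i ≠ 1 := by
    intro hi
    have hL := (dihedral_realizes_left (n := n) (s := s) ht).lift_gen i
    have hR := (dihedral_realizes_right (n := n) (t := t) hs).lift_gen i
    have h_sr {k : ℕ} (j : ZMod k) : (1 : DihedralGroup k) ≠ sr j := nofun
    rw [hi, map_one] at hL hR
    fin_cases i
    exacts [h_sr _ hL, h_sr _ hL, h_sr _ hR]
  exact orderOf_eq_prime h_sq h_ne

lemma commute_gen (i j : Fin 3) (hij : (i : ℕ) + 1 < j) :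
    Commute (gen n s t i) (gen n s t j) := by
  obtain rfl : i = 0 := by omega
  obtain rfl : j = 2 := by omega
  exact (gen_realizes n s t).commute₀₂

lemma isStringCGroup_gen (hs : 1 ≤ s) (ht : 1 ≤ t) : IsStringCGroup (gen n s t) where
  involution := orderOf_gen hs ht
  generates := closure_range_gen n s t
  string := commute_gen
  intersection := gen_intersection hs ht

end Orders

section Translations

open Subgroup

variable {G : Type*} [Group G] {s t : ℕ} {r₀ r₁ r₂ : G}

/-- In `[4, 4]`, acting on the plane by the symmetries of the tiling by unit squares, with `r₀, r₂`
the reflections in two orthogonal lines and `r₁` in a diagonal, this is the unit translation along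
the first axis. -/
def trX (r₀ r₁ r₂ : G) : G := r₀ * (r₁ * r₂ * r₁)

/-- The unit translation along the second axis in `[4, 4]`; see `trX`. -/
def trY (r₀ r₁ r₂ : G) : G := r₁ * r₀ * r₁ * r₂

namespace BaseRelations

lemma inv₀ (h : BaseRelations s t r₀ r₁ r₂) : r₀⁻¹ = r₀ := inv_eq_of_mul_eq_one_left h.mul_self₀

lemma inv₁ (h : BaseRelations s t r₀ r₁ r₂) : r₁⁻¹ = r₁ := inv_eq_of_mul_eq_one_left h.mul_self₁

lemma inv₂ (h : BaseRelations s t r₀ r₁ r₂) : r₂⁻¹ = r₂ := inv_eq_of_mul_eq_one_left h.mul_self₂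

lemma conj₀_trX (h : BaseRelations s t r₀ r₁ r₂) :
    r₀ * trX r₀ r₁ r₂ * r₀⁻¹ = (trX r₀ r₁ r₂)⁻¹ := by
  simp [trX, h.inv₀, h.inv₁, h.inv₂, mul_assoc, ← mul_assoc r₀ r₀, h.mul_self₀]

lemma conj₁_trX (h : BaseRelations s t r₀ r₁ r₂) :
    r₁ * trX r₀ r₁ r₂ * r₁⁻¹ = trY r₀ r₁ r₂ := by
  simp [trX, trY, h.inv₁, mul_assoc, h.mul_self₁]

lemma conj₁_trY (h : BaseRelations s t r₀ r₁ r₂) :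
    r₁ * trY r₀ r₁ r₂ * r₁⁻¹ = trX r₀ r₁ r₂ := by
  simp [trX, trY, h.inv₁, mul_assoc, ← mul_assoc r₁ r₁, h.mul_self₁]

lemma conj₂_trY (h : BaseRelations s t r₀ r₁ r₂) :
    r₂ * trY r₀ r₁ r₂ * r₂⁻¹ = (trY r₀ r₁ r₂)⁻¹ := by
  simp [trY, h.inv₀, h.inv₁, h.inv₂, mul_assoc, h.mul_self₂]

lemma eq_trX_mul (h : BaseRelations s t r₀ r₁ r₂) : r₀ = trX r₀ r₁ r₂ * (r₁ * r₂ * r₁) := by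
  have h_conj : r₁ * r₂ * r₁ * (r₁ * r₂ * r₁) = 1 := by
    simp [mul_assoc, ← mul_assoc r₁ r₁, ← mul_assoc r₂ r₂, h.mul_self₁, h.mul_self₂]
  rw [trX, mul_assoc, h_conj, mul_one]

lemma commute_conj_conj (h : BaseRelations s t r₀ r₁ r₂) :
    Commute (r₁ * r₂ * r₁) (r₁ * r₀ * r₁) := by
  simpa only [h.inv₁] using h.commute₀₂.symm.conj r₁

lemma commute_conj₀ (h : BaseRelations 2 t r₀ r₁ r₂) : Commute r₀ (r₁ * r₀ * r₁) := by
  have h_sq : (r₀ * r₁) ^ 2 * (r₀ * r₁) ^ 2 = 1 := by rw [← pow_add]; exact h.pow₀₁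
  have := eq_inv_of_mul_eq_one_left h_sq
  simpa [pow_two, h.inv₀, h.inv₁, mul_assoc, Commute, SemiconjBy] using this

lemma commute_conj₂ (h : BaseRelations s 2 r₀ r₁ r₂) : Commute (r₁ * r₂ * r₁) r₂ := by
  have h_sq : (r₁ * r₂) ^ 2 * (r₁ * r₂) ^ 2 = 1 := by rw [← pow_add]; exact h.pow₁₂
  have := eq_inv_of_mul_eq_one_left h_sq
  simpa [pow_two, h.inv₂, h.inv₁, mul_assoc, Commute, SemiconjBy] using this

lemma conj₀_trY (h : BaseRelations 2 t r₀ r₁ r₂) : r₀ * trY r₀ r₁ r₂ * r₀⁻¹ = trY r₀ r₁ r₂ :=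
  mul_inv_eq_iff_eq_mul.2 (h.commute_conj₀.mul_right h.commute₀₂)

lemma conj₂_trX (h : BaseRelations s 2 r₀ r₁ r₂) : r₂ * trX r₀ r₁ r₂ * r₂⁻¹ = trX r₀ r₁ r₂ :=
  mul_inv_eq_iff_eq_mul.2 (h.commute₀₂.symm.mul_right h.commute_conj₂.symm)

lemma commute_tr (h : BaseRelations 2 2 r₀ r₁ r₂) : Commute (trX r₀ r₁ r₂) (trY r₀ r₁ r₂) :=
  (h.commute_conj₀.mul_right h.commute₀₂).mul_left (h.commute_conj_conj.mul_right h.commute_conj₂)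

lemma comm_sq_right (h : BaseRelations s t r₀ r₁ r₂) :
    comm ((r₀ * r₁) ^ 2) r₂ = trY r₀ r₁ r₂ ^ 2 := by
  have h_conj : r₀ * (r₂ * r₀) = r₂ := by
    rw [← h.commute₀₂.eq, ← mul_assoc, h.mul_self₀, one_mul]
  simp only [comm, trY, pow_two, mul_inv_rev, h.inv₀, h.inv₁, h.inv₂, mul_assoc]
  rw [← mul_assoc r₂ r₀, ← mul_assoc r₀ (r₂ * r₀), h_conj]

lemma comm_sq_sq (h : BaseRelations 2 2 r₀ r₁ r₂) :
    comm ((r₀ * r₁) ^ 2) ((r₁ * r₂) ^ 2) = trX r₀ r₁ r₂ ^ 2 * trY r₀ r₁ r₂ ^ 2 := by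
  have h_inv₀₁ : ((r₀ * r₁) ^ 2)⁻¹ = (r₀ * r₁) ^ 2 := by
    rw [inv_eq_iff_mul_eq_one, ← pow_add]; exact h.pow₀₁
  have h_inv₁₂ : ((r₁ * r₂) ^ 2)⁻¹ = (r₁ * r₂) ^ 2 := by
    rw [inv_eq_iff_mul_eq_one, ← pow_add]; exact h.pow₁₂
  have h_mul : (r₀ * r₁) ^ 2 * (r₁ * r₂) ^ 2 = trX r₀ r₁ r₂ * trY r₀ r₁ r₂ := by
    calc (r₀ * r₁) ^ 2 * (r₁ * r₂) ^ 2 = r₀ * (r₁ * r₀ * r₁) * (r₁ * r₂ * r₁ * r₂) := by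
          simp only [pow_two, mul_assoc]
      _ = trX r₀ r₁ r₂ * trY r₀ r₁ r₂ := h.commute_conj_conj.symm.mul_mul_mul_comm _ _
  rw [comm, h_inv₀₁, h_inv₁₂, mul_assoc, h_mul, ← h.commute_tr.mul_pow, pow_two]

lemma extraRelator_odd (h : BaseRelations 2 2 r₀ r₁ r₂) (k : ℕ) :
    extraRelator (2 * k + 5) 2 2 r₀ r₁ r₂ = trY r₀ r₁ r₂ ^ 2 ^ (k + 1) := by
  have h_sub : 2 * k + 5 - 2 - 2 = 2 * k + 1 := by omega
  have h_half : (2 * k + 1 - 1) / 2 = k := by omega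
  rw [extraRelator, h_sub, if_pos ⟨k, rfl⟩, h_half, h.comm_sq_right, ← pow_mul, pow_succ']

lemma extraRelator_even (h : BaseRelations 2 2 r₀ r₁ r₂) (k : ℕ) :
    extraRelator (2 * k + 6) 2 2 r₀ r₁ r₂ =
      trX r₀ r₁ r₂ ^ 2 ^ (k + 1) * trY r₀ r₁ r₂ ^ 2 ^ (k + 1) := by
  have h_sub : 2 * k + 6 - 2 - 2 = 2 * (k + 1) := by omega
  have h_half : (2 * (k + 1) - 2) / 2 = k := by omega
  rw [extraRelator, h_sub, if_neg (by simp), h_half, h.comm_sq_sq,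
    (h.commute_tr.pow_pow 2 2).mul_pow, ← pow_mul, ← pow_mul, pow_succ']

lemma closure_tr_normal (h : BaseRelations 2 2 r₀ r₁ r₂) (hgen : closure {r₀, r₁, r₂} = ⊤) :
    (closure {trX r₀ r₁ r₂, trY r₀ r₁ r₂}).Normal := by
  have hX : trX r₀ r₁ r₂ ∈ closure {trX r₀ r₁ r₂, trY r₀ r₁ r₂} := subset_closure (by simp)
  have hY : trY r₀ r₁ r₂ ∈ closure {trX r₀ r₁ r₂, trY r₀ r₁ r₂} := subset_closure (by simp)
  refine closure_normal_of_mul_self hgen h.mul_self ?_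
  rintro g (hg | hg | hg) x (hx | hx) <;> subst hg <;> subst hx
  · rw [h.conj₀_trX]; exact inv_mem hX
  · rw [h.conj₀_trY]; exact hY
  · rw [h.conj₁_trX]; exact hY
  · rw [h.conj₁_trY]; exact hX
  · rw [h.conj₂_trX]; exact hX
  · rw [h.conj₂_trY]; exact inv_mem hY

lemma card_vertexStabilizer_dvd (h : BaseRelations s t r₀ r₁ r₂) :
    Nat.card ↥(zpowers (r₁ * r₂) ⊔ zpowers r₁) ∣ 2 ^ t * 2 := by
  have h_norm : zpowers r₁ ≤ normalizer (zpowers (r₁ * r₂)) := by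
    rw [zpowers_le, zpowers_eq_closure (r₁ * r₂)]
    refine mem_normalizer_closure_of_mul_self h.mul_self₁ ?_
    rintro _ rfl
    have h_conj := conj_left_mul_pow h.mul_self₁ h.mul_self₂ 1
    rw [pow_one] at h_conj
    exact h_conj ▸ inv_mem (mem_closure_singleton_self _)
  refine (card_sup_dvd h_norm).trans (mul_dvd_mul ?_ ?_) <;> rw [Nat.card_zpowers]
  exacts [orderOf_dvd_of_pow_eq_one h.pow₁₂,
    orderOf_dvd_of_pow_eq_one ((pow_two _).trans h.mul_self₁)]

lemma closure_tr_sup (h : BaseRelations s t r₀ r₁ r₂) (hgen : closure {r₀, r₁, r₂} = ⊤) :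
    closure {trX r₀ r₁ r₂, trY r₀ r₁ r₂} ⊔ (zpowers (r₁ * r₂) ⊔ zpowers r₁) = ⊤ := by
  have hX : trX r₀ r₁ r₂ ∈
      closure {trX r₀ r₁ r₂, trY r₀ r₁ r₂} ⊔ (zpowers (r₁ * r₂) ⊔ zpowers r₁) :=
    mem_sup_left (subset_closure (by simp))
  have h₁₂ : r₁ * r₂ ∈ closure {trX r₀ r₁ r₂, trY r₀ r₁ r₂} ⊔ (zpowers (r₁ * r₂) ⊔ zpowers r₁) :=
    mem_sup_right (mem_sup_left (mem_zpowers _))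
  have h₁ : r₁ ∈ closure {trX r₀ r₁ r₂, trY r₀ r₁ r₂} ⊔ (zpowers (r₁ * r₂) ⊔ zpowers r₁) :=
    mem_sup_right (mem_sup_right (mem_zpowers _))
  rw [eq_top_iff, ← hgen, closure_le]
  rintro g (hg | hg | hg) <;> subst hg
  · have h₀ := mul_mem hX (mul_mem h₁₂ h₁)
    rwa [← h.eq_trX_mul] at h₀
  · exact h₁
  · exact (mul_mem_cancel_left h₁).1 h₁₂

lemma card_dvd_card_closure_tr_mul (h : BaseRelations 2 2 r₀ r₁ r₂)
    (hgen : closure {r₀, r₁, r₂} = ⊤) :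
    Nat.card G ∣ Nat.card (closure {trX r₀ r₁ r₂, trY r₀ r₁ r₂}) * 8 := by
  have := h.closure_tr_normal hgen
  rw [← Subgroup.card_top, ← h.closure_tr_sup hgen]
  exact (card_sup_dvd le_normalizer_of_normal).trans
    (mul_dvd_mul_left _ h.card_vertexStabilizer_dvd)

lemma card_dvd_of_trY_pow {m : ℕ} (h : BaseRelations 2 2 r₀ r₁ r₂)
    (hgen : closure {r₀, r₁, r₂} = ⊤) (hY : trY r₀ r₁ r₂ ^ m = 1) :
    Nat.card G ∣ m * m * 8 := by
  have hX : trX r₀ r₁ r₂ ^ m = 1 := by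
    rw [← h.conj₁_trY, conj_pow, hY, mul_one, mul_inv_cancel]
  refine (h.card_dvd_card_closure_tr_mul hgen).trans (mul_dvd_mul_right ?_ 8)
  exact (card_closure_pair_dvd h.commute_tr).trans
    (mul_dvd_mul (orderOf_dvd_of_pow_eq_one hX) (orderOf_dvd_of_pow_eq_one hY))

lemma card_dvd_of_trX_pow_mul_trY_pow {m : ℕ} (h : BaseRelations 2 2 r₀ r₁ r₂)
    (hgen : closure {r₀, r₁, r₂} = ⊤) (hXY : trX r₀ r₁ r₂ ^ m * trY r₀ r₁ r₂ ^ m = 1) :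
    Nat.card G ∣ 2 * m * m * 8 := by
  set X := trX r₀ r₁ r₂
  set Y := trY r₀ r₁ r₂
  have h_eq : X ^ m = Y ^ m := by
    have h_conj : r₀ * (X ^ m * Y ^ m) * r₀⁻¹ = 1 := by rw [hXY, mul_one, mul_inv_cancel]
    rwa [← conj_mul, ← conj_pow, ← conj_pow, h.conj₀_trX, h.conj₀_trY, inv_pow, inv_mul_eq_one]
      at h_conj
  have hX : X ^ (2 * m) = 1 := by
    rw [two_mul, pow_add]
    nth_rewrite 2 [h_eq]
    exact hXY
  have hXY' : (X * Y) ^ m = 1 := by rw [h.commute_tr.mul_pow, hXY]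
  have h_le : closure {X, Y} ≤ closure {X, X * Y} := by
    have hX_mem : X ∈ closure {X, X * Y} := subset_closure (by simp)
    have hXY_mem : X * Y ∈ closure {X, X * Y} := subset_closure (by simp)
    rw [closure_le, Set.pair_subset_iff]
    exact ⟨hX_mem, (mul_mem_cancel_left hX_mem).1 hXY_mem⟩
  refine (h.card_dvd_card_closure_tr_mul hgen).trans (mul_dvd_mul_right ?_ 8)
  calc Nat.card (closure {X, Y}) ∣ Nat.card (closure {X, X * Y}) := card_dvd_of_le h_le
    _ ∣ orderOf X * orderOf (X * Y) :=
      card_closure_pair_dvd ((Commute.refl X).mul_right h.commute_tr)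
    _ ∣ 2 * m * m :=
      mul_dvd_mul (orderOf_dvd_of_pow_eq_one hX) (orderOf_dvd_of_pow_eq_one hXY')

end BaseRelations

end Translations

section Reduction

open Subgroup

variable {n s t : ℕ}

/-- The subgroup of `H n s t` generated by `(ρ₀ρ₁)⁴` and `(ρ₁ρ₂)⁴`. -/
def powFour (n s t : ℕ) : Subgroup (H n s t) :=
  closure {(gen n s t 0 * gen n s t 1) ^ 4, (gen n s t 1 * gen n s t 2) ^ 4}

instance powFour_normal : (powFour n s t).Normal :=
  (gen_realizes n s t).closure_pow_four_normal (closure_gen n s t)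

lemma disjoint_zpowers_pow_four (ht : 1 ≤ t) :
    Disjoint (zpowers ((gen n s t 0 * gen n s t 1) ^ 4))
      (zpowers ((gen n s t 1 * gen n s t 2) ^ 4)) := by
  have h := gen_realizes n s t
  have h_real : Realizes n s t (gen n s t 0) (gen n s t 1) 1 :=
    realizes_one_right ht h.mul_self₀ h.mul_self₁ h.pow₀₁
  have h_fix : h_real.lift ((gen n s t 0 * gen n s t 1) ^ 4) = (gen n s t 0 * gen n s t 1) ^ 4 := by
    rw [map_pow, map_mul, Realizes.lift_gen, Realizes.lift_gen]; rfl
  have h_kill : h_real.lift ((gen n s t 1 * gen n s t 2) ^ 4) = 1 := by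
    rw [map_pow, map_mul, Realizes.lift_gen, Realizes.lift_gen]
    exact pow_four_eq_one (by simpa using h.mul_self₁)
  rw [disjoint_def]
  rintro _ ⟨i, rfl⟩ ⟨j, hj⟩
  have := congrArg h_real.lift hj
  simp only [map_zpow, h_fix, h_kill, one_zpow] at this
  exact this.symm

lemma card_powFour (n s t : ℕ) : Nat.card (powFour n (s + 2) (t + 2)) = 2 ^ s * 2 ^ t := by
  rw [powFour, card_closure_pair_of_disjoint (gen_realizes _ _ _).commute_pow_pow
    (disjoint_zpowers_pow_four (Nat.le_add_left 1 _)),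
    orderOf_pow_four (orderOf_gen₀₁ (Nat.le_add_left 1 _)),
    orderOf_pow_four (orderOf_gen₁₂ (Nat.le_add_left 1 _))]

lemma extraRelator_add {G : Type*} [Group G] (n s t : ℕ) (r₀ r₁ r₂ : G) :
    extraRelator (n + s + t) (s + 2) (t + 2) r₀ r₁ r₂ = extraRelator n 2 2 r₀ r₁ r₂ := by
  have h_sub : n + s + t - (s + 2) - (t + 2) = n - 2 - 2 := by omega
  simp only [extraRelator, h_sub]

lemma gen_realizes_add (n s t : ℕ) :
    Realizes (n + s + t) (s + 2) (t + 2) (gen n 2 2 0) (gen n 2 2 1) (gen n 2 2 2) where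
  toBaseRelations := (gen_realizes n 2 2).mono (Nat.le_add_left 2 s) (Nat.le_add_left 2 t)
  extra := (extraRelator_add n s t _ _ _).trans (gen_realizes n 2 2).extra

lemma mk_powFour_realizes (n s t : ℕ) :
    Realizes n 2 2
      (gen (n + s + t) (s + 2) (t + 2) 0 : H (n + s + t) (s + 2) (t + 2) ⧸ powFour _ _ _)
      (gen (n + s + t) (s + 2) (t + 2) 1) (gen (n + s + t) (s + 2) (t + 2) 2) := by
  have h := (gen_realizes (n + s + t) (s + 2) (t + 2)).map (QuotientGroup.mk' (powFour _ _ _))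
  refine ⟨.of_pow_four h.mul_self₀ h.mul_self₁ h.mul_self₂ ?_ ?_ h.commute₀₂,
    (extraRelator_add n s t _ _ _).symm.trans h.extra⟩
  · exact (QuotientGroup.eq_one_iff _).2 (subset_closure (Set.mem_insert _ _))
  · exact (QuotientGroup.eq_one_iff _).2 (subset_closure (Set.mem_insert_of_mem _ rfl))

lemma ker_lift_gen_realizes_add (n s t : ℕ) :
    (gen_realizes_add n s t).lift.ker = powFour (n + s + t) (s + 2) (t + 2) := by
  apply le_antisymm
  · have h_comp : (mk_powFour_realizes n s t).lift.comp (gen_realizes_add n s t).lift =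
        QuotientGroup.mk' (powFour (n + s + t) (s + 2) (t + 2)) := by
      refine PresentedGroup.ext fun i => ?_
      change (mk_powFour_realizes n s t).lift ((gen_realizes_add n s t).lift (gen _ _ _ i)) = _
      rw [Realizes.lift_gen]
      fin_cases i <;> exact Realizes.lift_gen _ _
    rw [← QuotientGroup.ker_mk' (powFour (n + s + t) (s + 2) (t + 2)), ← h_comp]
    rw [← MonoidHom.comap_ker]
    exact ker_le_comap _ _
  · rw [powFour, closure_le]
    rintro _ (rfl | rfl) <;>
      rw [SetLike.mem_coe, MonoidHom.mem_ker, map_pow, map_mul, Realizes.lift_gen,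
        Realizes.lift_gen]
    exacts [(gen_realizes n 2 2).pow₀₁, (gen_realizes n 2 2).pow₁₂]

lemma card_H_add (n s t : ℕ) :
    Nat.card (H (n + s + t) (s + 2) (t + 2)) = 2 ^ s * 2 ^ t * Nat.card (H n 2 2) := by
  rw [← card_powFour (n + s + t), ← ker_lift_gen_realizes_add,
    ← (gen_realizes_add n s t).lift.ker.card_mul_index, index_ker,
    MonoidHom.range_eq_top.2 (Realizes.lift_surjective _ (closure_gen n 2 2)), card_top]

end Reduction

section Wreath

open Subgroup RegularWreathProduct

variable {D Q : Type*} [Group D] [Group Q]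

/-- The inclusion of the base group into the wreath product `D ≀ᵣ Q`. -/
def base : (Q → D) →* D ≀ᵣ Q where
  toFun f := ⟨f, 1⟩
  map_one' := rfl
  map_mul' f g := by ext <;> simp

lemma base_mul_inl (w : D ≀ᵣ Q) : base w.left * inl w.right = w := by
  ext <;> simp [base]

lemma inl_mul_base_mul (g : Q) (f : Q → D) :
    inl g * base f * (inl g)⁻¹ = base fun q => f (g⁻¹ * q) := by
  ext <;> simp [base]

lemma base_const_mem_center {z : D} (hz : z ∈ center D) :
    base (fun _ => z) ∈ center (D ≀ᵣ Q) := by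
  refine mem_center_iff.2 fun w => ?_
  ext
  · simp [base, mem_center_iff.1 hz]
  · simp [base]

variable [DecidableEq Q]

/-- The inclusion of the factor with index `q` of the base group into the wreath product. -/
def single (q : Q) : D →* D ≀ᵣ Q := base.comp (MonoidHom.mulSingle (fun _ => D) q)

lemma inl_mul_single_mul (g q : Q) (x : D) :
    inl g * single q x * (inl g)⁻¹ = single (g * q) x := by
  refine (inl_mul_base_mul g _).trans (congrArg base ?_)
  ext q'
  simp [Pi.mulSingle_apply, inv_mul_eq_iff_eq_mul]

lemma commute_single {q q' : Q} (h : q ≠ q') (x y : D) :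
    Commute (single q x) (single q' y) :=
  (Pi.mulSingle_commute (f := fun _ => D) h x y).map base

variable {q : Q} {a b : D}

lemma inl_mul_single_mul_inl (hq : q * q = 1) (q' : Q) (x : D) :
    inl q * single q' x * inl q = single (q * q') x := by
  rw [← inl_mul_single_mul, ← map_inv, inv_eq_of_mul_eq_one_left hq]

lemma single_mul_inl_pow_four (hq : q * q = 1) (q' : Q) (ha : a * a = 1) :
    (single q' a * inl q) ^ 4 = 1 := by
  have h_sq : (single q' a * inl q) ^ 2 = single q' a * single (q * q') a := by
    rw [← inl_mul_single_mul_inl hq, pow_two]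
    simp only [mul_assoc]
  have h_comm : Commute (single q' a) (single (q * q') a) := by
    obtain h | h := eq_or_ne q' (q * q')
    exacts [h ▸ Commute.refl _, commute_single h a a]
  rw [pow_mul _ 2 2, h_sq, h_comm.mul_pow, ← map_pow, ← map_pow, pow_two, ha, map_one, map_one,
    one_mul]

lemma wreath_baseRelations (hq : q * q = 1) (hq_ne : q ≠ 1) (ha : a * a = 1) (hb : b * b = 1) :
    BaseRelations 2 2 (single 1 a) (inl q) (single q b) := by
  have h_inl : (inl q : D ≀ᵣ Q) * inl q = 1 := by rw [← map_mul, hq, map_one]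
  have h_single (q' : Q) {x : D} (hx : x * x = 1) : single q' x * single q' x = 1 := by
    rw [← map_mul, hx, map_one]
  refine .of_pow_four (h_single 1 ha) h_inl (h_single q hb)
    (single_mul_inl_pow_four hq 1 ha) ?_ (commute_single hq_ne.symm a b)
  rw [← inv_eq_one, ← inv_pow, mul_inv_rev, inv_eq_of_mul_eq_one_left h_inl,
    inv_eq_of_mul_eq_one_left (h_single q hb), single_mul_inl_pow_four hq q hb]

lemma trX_wreath (hq : q * q = 1) :
    trX (single 1 a) (inl q) (single q b) = single 1 (a * b) := by
  rw [trX, inl_mul_single_mul_inl hq, hq, map_mul]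

lemma trY_wreath (hq : q * q = 1) :
    trY (single 1 a) (inl q) (single q b) = single q (a * b) := by
  rw [trY, inl_mul_single_mul_inl hq, mul_one, map_mul]

lemma base_eq_single_mul_single (f : ℤˣ → D) :
    base f = single 1 (f 1) * single (-1) (f (-1)) := by
  refine (congrArg base ?_).trans (map_mul base _ _)
  ext u
  obtain rfl | rfl := Int.units_eq_one_or u <;> simp

lemma closure_wreath (hab : closure {a, b} = ⊤) :
    closure {(single 1 a : D ≀ᵣ ℤˣ), inl (-1), single (-1) b} = ⊤ := by
  set L := closure {(single 1 a : D ≀ᵣ ℤˣ), inl (-1), single (-1) b}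
  have h_inl : inl (-1) ∈ L := subset_closure (by simp)
  have h_conj {u : ℤˣ} {x : D} (hx : single u x ∈ L) : single (-u) x ∈ L := by
    rw [← neg_one_mul u, ← inl_mul_single_mul]
    exact mul_mem (mul_mem h_inl hx) (inv_mem h_inl)
  have h_one (x : D) : single 1 x ∈ L := by
    have h_le : closure {a, b} ≤ L.comap (single 1) := by
      rw [closure_le, Set.pair_subset_iff]
      refine ⟨subset_closure (by simp), ?_⟩
      rw [← neg_neg 1]
      exact h_conj (subset_closure (by simp))
    exact h_le (hab ▸ mem_top x)
  refine (eq_top_iff' _).2 fun w => ?_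
  rw [← base_mul_inl w, base_eq_single_mul_single]
  refine mul_mem (mul_mem (h_one _) (h_conj (h_one _))) ?_
  obtain h | h := Int.units_eq_one_or w.right <;> rw [h]
  exacts [map_one (inl : ℤˣ →* D ≀ᵣ ℤˣ) ▸ one_mem L, h_inl]

lemma card_wreath (D : Type*) : Nat.card (D ≀ᵣ ℤˣ) = Nat.card D ^ 2 * 2 := by
  simp [RegularWreathProduct.card]

end Wreath

section Dihedral

open Subgroup DihedralGroup

lemma closure_sr_zero_sr_one (m : ℕ) : closure {(sr 0 : DihedralGroup m), sr 1} = ⊤ := by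
  have h₀ : (sr 0 : DihedralGroup m) ∈ closure {(sr 0 : DihedralGroup m), sr 1} :=
    subset_closure (by simp)
  have h₁ : (sr 1 : DihedralGroup m) ∈ closure {(sr 0 : DihedralGroup m), sr 1} :=
    subset_closure (by simp)
  have h_r (i : ZMod m) : r i ∈ closure {(sr 0 : DihedralGroup m), sr 1} := by
    obtain ⟨i, rfl⟩ := ZMod.intCast_surjective i
    have := zpow_mem (mul_mem h₀ h₁) i
    rwa [sr_mul_sr, sub_zero, r_one_zpow] at this
  refine (eq_top_iff' _).2 ?_
  rintro (i | i)
  · exact h_r i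
  · simpa using mul_mem h₀ (h_r i)

lemma r_natCast_mem_center (m : ℕ) : (r m : DihedralGroup (2 * m)) ∈ center _ := by
  have h_two : (m : ZMod (2 * m)) + m = 0 := by
    rw [← two_mul]
    exact_mod_cast ZMod.natCast_self (2 * m)
  have h_neg : -(m : ZMod (2 * m)) = m := neg_eq_of_add_eq_zero_left h_two
  refine mem_center_iff.2 ?_
  rintro (i | i)
  · simp [add_comm]
  · simp [sub_eq_add_neg, h_neg]

end Dihedral

section Order

open Subgroup DihedralGroup RegularWreathProduct

lemma Realizes.card_dvd {G : Type*} [Group G] {n s t : ℕ} {r₀ r₁ r₂ : G}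
    (h : Realizes n s t r₀ r₁ r₂) (hgen : closure {r₀, r₁, r₂} = ⊤) :
    Nat.card G ∣ Nat.card (H n s t) :=
  card_dvd_of_surjective _ (h.lift_surjective hgen)

lemma dihedralWreath_baseRelations (m : ℕ) :
    BaseRelations 2 2 (single 1 (sr 0) : DihedralGroup m ≀ᵣ ℤˣ) (inl (-1)) (single (-1) (sr 1)) :=
  wreath_baseRelations (by simp) (by decide) (sr_mul_self 0) (sr_mul_self 1)

lemma trX_dihedralWreath (m : ℕ) :
    trX (single 1 (sr 0) : DihedralGroup m ≀ᵣ ℤˣ) (inl (-1)) (single (-1) (sr 1)) =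
      single 1 (r 1) := by
  rw [trX_wreath (by simp), sr_mul_sr, sub_zero]

lemma trY_dihedralWreath (m : ℕ) :
    trY (single 1 (sr 0) : DihedralGroup m ≀ᵣ ℤˣ) (inl (-1)) (single (-1) (sr 1)) =
      single (-1) (r 1) := by
  rw [trY_wreath (by simp), sr_mul_sr, sub_zero]

lemma closure_dihedralWreath (m : ℕ) :
    closure {(single 1 (sr 0) : DihedralGroup m ≀ᵣ ℤˣ), inl (-1), single (-1) (sr 1)} = ⊤ :=
  closure_wreath (closure_sr_zero_sr_one m)

lemma card_dihedralWreath (m : ℕ) : Nat.card (DihedralGroup m ≀ᵣ ℤˣ) = (2 * m) ^ 2 * 2 := by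
  rw [card_wreath, DihedralGroup.nat_card]

lemma dihedralWreath_realizes (k : ℕ) :
    Realizes (2 * k + 5) 2 2 (single 1 (sr 0) : DihedralGroup (2 ^ (k + 1)) ≀ᵣ ℤˣ) (inl (-1))
      (single (-1) (sr 1)) := by
  refine ⟨dihedralWreath_baseRelations _, ?_⟩
  rw [(dihedralWreath_baseRelations _).extraRelator_odd, trY_dihedralWreath, ← map_pow,
    r_one_pow_n, map_one]

lemma card_H_odd (k : ℕ) : Nat.card (H (2 * k + 5) 2 2) = 2 ^ (2 * k + 5) := by
  apply Nat.dvd_antisymm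
  · have h := gen_realizes (2 * k + 5) 2 2
    have hY := (h.extraRelator_odd k).symm.trans h.extra
    calc Nat.card (H (2 * k + 5) 2 2) ∣ 2 ^ (k + 1) * 2 ^ (k + 1) * 8 :=
          h.card_dvd_of_trY_pow (closure_gen _ _ _) hY
      _ = 2 ^ (2 * k + 5) := by ring
  · calc 2 ^ (2 * k + 5) = Nat.card (DihedralGroup (2 ^ (k + 1)) ≀ᵣ ℤˣ) := by
          rw [card_dihedralWreath]; ring
      _ ∣ Nat.card (H (2 * k + 5) 2 2) :=
          (dihedralWreath_realizes k).card_dvd (closure_dihedralWreath _)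

/-- The diagonal copy in `DihedralGroup (2 * m) ≀ᵣ ℤˣ` of the central involution `r m`. Since
`trX` and `trY` are the two copies of `r 1`, this is the element `trX ^ m * trY ^ m`. -/
def diagonalInvolution (m : ℕ) : DihedralGroup (2 * m) ≀ᵣ ℤˣ := base fun _ => r m

lemma single_pow_mul_single_pow (m : ℕ) :
    single 1 (r 1) ^ m * single (-1) (r 1) ^ m = diagonalInvolution m := by
  rw [diagonalInvolution, base_eq_single_mul_single, ← map_pow, ← map_pow, r_one_pow]

lemma diagonalInvolution_sq (m : ℕ) : diagonalInvolution m ^ 2 = 1 := by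
  have h_sq : (r m : DihedralGroup (2 * m)) ^ 2 = 1 := by
    rw [← r_one_pow, ← pow_mul, mul_comm, r_one_pow_n]
  rw [diagonalInvolution, ← map_pow]
  exact (congrArg base (funext fun _ => h_sq)).trans (map_one base)

instance zpowers_diagonalInvolution_normal (m : ℕ) : (zpowers (diagonalInvolution m)).Normal :=
  zpowers_normal_of_mem_center (base_const_mem_center (r_natCast_mem_center m))

lemma dihedralWreath_quotient_realizes (k : ℕ) :
    Realizes (2 * k + 6) 2 2
      ((single 1 (sr 0) : DihedralGroup (2 * 2 ^ (k + 1)) ≀ᵣ ℤˣ) :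
        (DihedralGroup (2 * 2 ^ (k + 1)) ≀ᵣ ℤˣ) ⧸ zpowers (diagonalInvolution (2 ^ (k + 1))))
      (inl (-1) : DihedralGroup (2 * 2 ^ (k + 1)) ≀ᵣ ℤˣ)
      (single (-1) (sr 1) : DihedralGroup (2 * 2 ^ (k + 1)) ≀ᵣ ℤˣ) := by
  have h := dihedralWreath_baseRelations (2 * 2 ^ (k + 1))
  set π := QuotientGroup.mk' (zpowers (diagonalInvolution (2 ^ (k + 1))))
  refine ⟨h.map π, (map_extraRelator π _ _ _ _ _ _).symm.trans ?_⟩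
  rw [h.extraRelator_even, trX_dihedralWreath, trY_dihedralWreath, single_pow_mul_single_pow]
  exact (QuotientGroup.eq_one_iff _).2 (mem_zpowers _)

lemma card_H_even (k : ℕ) : Nat.card (H (2 * k + 6) 2 2) = 2 ^ (2 * k + 6) := by
  apply Nat.dvd_antisymm
  · have h := gen_realizes (2 * k + 6) 2 2
    have hXY := (h.extraRelator_even k).symm.trans h.extra
    calc Nat.card (H (2 * k + 6) 2 2) ∣ 2 * 2 ^ (k + 1) * 2 ^ (k + 1) * 8 :=
          h.card_dvd_of_trX_pow_mul_trY_pow (closure_gen _ _ _) hXY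
      _ = 2 ^ (2 * k + 6) := by ring
  · refine Nat.dvd_of_mul_dvd_mul_right two_pos ?_
    calc 2 ^ (2 * k + 6) * 2 = Nat.card (DihedralGroup (2 * 2 ^ (k + 1)) ≀ᵣ ℤˣ) := by
          rw [card_dihedralWreath]; ring
      _ ∣ Nat.card (_ ⧸ zpowers (diagonalInvolution (2 ^ (k + 1)))) * 2 :=
          card_dvd_card_quotient_mul_of_pow_eq_one (diagonalInvolution_sq _)
      _ ∣ Nat.card (H (2 * k + 6) 2 2) * 2 :=
          mul_dvd_mul_right ((dihedralWreath_quotient_realizes k).card_dvd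
            (closure_map_triple (QuotientGroup.mk'_surjective _) (closure_dihedralWreath _))) 2

lemma card_H_two_two {n : ℕ} (hn : 5 ≤ n) : Nat.card (H n 2 2) = 2 ^ n := by
  obtain ⟨k, hk⟩ := Nat.even_or_odd' (n - 5)
  obtain rfl | rfl : n = 2 * k + 5 ∨ n = 2 * k + 6 := by omega
  exacts [card_H_odd k, card_H_even k]

lemma card_H {n s t : ℕ} (hs : 2 ≤ s) (ht : 2 ≤ t) (hst : s + t < n) :
    Nat.card (H n s t) = 2 ^ n := by
  obtain ⟨s, rfl⟩ := Nat.exists_eq_add_of_le' hs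
  obtain ⟨t, rfl⟩ := Nat.exists_eq_add_of_le' ht
  obtain ⟨n, rfl⟩ : ∃ m, n = m + s + t := ⟨n - s - t, by omega⟩
  rw [card_H_add, card_H_two_two (by omega)]
  ring

end Order

end StringC

theorem theorem1p2_general (n s t : ℕ) (hs : 2 ≤ s) (ht : 2 ≤ t) (hst : s + t < n) :
    StringC.IsStringCGroup (StringC.gen n s t) ∧
      Nat.card (StringC.H n s t) = 2 ^ n ∧
      StringC.HasSchlafliType (StringC.gen n s t) ![2 ^ s, 2 ^ t] :=
  have hs' := one_le_two.trans hs
  have ht' := one_le_two.trans ht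
  ⟨StringC.isStringCGroup_gen hs' ht', StringC.card_H hs ht hst,
    StringC.hasSchlafliType_gen hs' ht'⟩

theorem theorem1p2 (n s t : ℕ) (hn : 10 ≤ n) (hs : 2 ≤ s) (ht : 2 ≤ t) (hst : s + t ≤ n - 1) :
    StringC.IsStringCGroup (StringC.gen n s t) ∧
      Nat.card (StringC.H n s t) = 2 ^ n ∧
      StringC.HasSchlafliType (StringC.gen n s t) ![2 ^ s, 2 ^ t] :=
  theorem1p2_general n s t hs ht (by omega)
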